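/- Let $(\Omega,\mathcal F,\mu)$ be a $\sigma$-finite measure space and let $\mathcal M$ be the set of ($\mu$-a.e. classes of) probability densities with respect to $\mu$ that are strictly positive $\mu$-a.e. For $p\in\mathcal M$ write $\mathbb E_p[v]=\int v\,p\,d\mu$ and $\Phi=\cosh-1$. Let $L^\Phi(p)$ be the Orlicz space of random variables $v$ with $\mathbb E_p[\Phi(\alpha v)]<\infty$ for some $\alpha>0$, with the Luxemburg norm $\|v\|=\inf\{r>0:\mathbb E_p[\Phi(v/r)]\le1\}$, and let $B_p=\{v\in L^\Phi(p):\mathbb E_p[v]=0\}$. Let $K_p(u)=\log\mathbb E_p[e^u]\in(-\infty,+\infty]$ for $u\in B_p$, let $\mathcal S_p$ be the interior in $B_p$ of $\{K_p<\infty\}$, and let $\mathcal E(p)=\{e^{u-K_p(u)}p:u\in\mathcal S_p\}$. The exponential manifold is the set $\mathcal M$ with the atlas of charts $$s_p:\mathcal E(p)\to\mathcal S_p\subset B_p,\qquad s_p(q)=\log\tfrac qp-\mathbb E_p\big[\log\tfrac qp\big],\qquad s_p^{-1}(u)=e^{u-K_p(u)}p\qquad(p\in\mathcal M);$$ its tangent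 space at $p$, read in the chart $s_p$, is $T_p\mathcal M=B_p$. Let $S$ be the unit sphere of $L^2(\mu)$, with $T_xS=\{x\}^\perp$ and the charts $y\mapsto y-\langle x,y\rangle x\in T_xS$ defined on $\{y\in S:\langle x,y\rangle>0\}$ $(x\in S)$. Then the map $\mathcal M\to S$, $p\mapsto\sqrt p$, is $C^\infty$: for all $p\in\mathcal M$ and $x\in S$, its representative in the charts at $p$ and at $x$ is defined on an open subset of $B_p$ and is $C^\infty$ there. Its derivative at $p\in\mathcal M$ in the direction $w\in T_p\mathcal M=B_p$ is $\tfrac12\,w\sqrt p\in T_{\sqrt p}S$; that is, both the representative of the map in the charts at $p$ and at $\sqrt p$, and the $L^2(\mu)$-valued map $u\mapsto\sqrt{s_p^{-1}(u)}$, are Fréchet differentiable at $s_p(p)=0$ with derivative $w\mapsto\tfrac12\,w\sqrt p$. -/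

import Mathlib

open MeasureTheory Set
open scoped ENNReal ContDiff Topology RealInnerProductSpace

noncomputable section

namespace ExpManifold

/-! ### Smooth maps between sets with atlases modelled on varying normed spaces -/

/-- Let `φ` and `ψ` be atlases on `X` and `Y`, whose charts may take values in different normed
spaces. A map `f : X → Y` is `C^∞` if the charts cover `X` and `f '' X` and if, for every chart
`φ i` of `X` and every chart `ψ j` of `Y`, the local representative `ψ j ∘ f ∘ (φ i)⁻¹` is defined
on an open subset of the model space of `φ i` and is `C^∞` there. -/
def IsSmoothMap {X Y ι κ : Type*} {E : ι → Type*} {F : κ → Type*}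
    [∀ i, NormedAddCommGroup (E i)] [∀ i, NormedSpace ℝ (E i)]
    [∀ j, NormedAddCommGroup (F j)] [∀ j, NormedSpace ℝ (F j)]
    (φ : ∀ i, PartialEquiv X (E i)) (ψ : ∀ j, PartialEquiv Y (F j)) (f : X → Y) : Prop :=
  (∀ x, ∃ i, x ∈ (φ i).source) ∧ (∀ x, ∃ j, f x ∈ (ψ j).source) ∧
    ∀ i j, IsOpen (φ i '' ((φ i).source ∩ f ⁻¹' (ψ j).source)) ∧
      ContDiffOn ℝ ∞ (ψ j ∘ f ∘ (φ i).symm) (φ i '' ((φ i).source ∩ f ⁻¹' (ψ j).source))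

/-! ### The unit sphere of a Hilbert space with its projection charts -/

section Sphere

variable {H : Type*} [NormedAddCommGroup H] [InnerProductSpace ℝ H]

/-- The tangent space `{x}ᗮ` of the unit sphere at `x`. -/
abbrev SphereTangent (x : Metric.sphere (0 : H) 1) : Submodule ℝ H := (ℝ ∙ (x : H))ᗮ

theorem inner_sphereTangent (x : Metric.sphere (0 : H) 1) (u : SphereTangent x) :
    ⟪(x : H), (u : H)⟫ = 0 :=
  Submodule.mem_orthogonal_singleton_iff_inner_right.1 u.2

theorem inner_self_sphere (x : Metric.sphere (0 : H) 1) : ⟪(x : H), (x : H)⟫ = 1 := by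
  rw [real_inner_self_eq_norm_sq, norm_eq_of_mem_sphere]; norm_num

/-- The orthogonal projection `y ↦ y - ⟪x, y⟫ x` onto the tangent space at `x`. -/
def sphereProj (x : Metric.sphere (0 : H) 1) (y : H) : SphereTangent x :=
  ⟨y - ⟪(x : H), y⟫ • (x : H), by
    rw [Submodule.mem_orthogonal_singleton_iff_inner_right, inner_sub_right, inner_smul_right,
      inner_self_sphere, mul_one, sub_self]⟩

theorem norm_spherePatch (x : Metric.sphere (0 : H) 1) (u : SphereTangent x) (hu : ‖u‖ ≤ 1) :
    (u : H) + √(1 - ‖u‖ ^ 2) • (x : H) ∈ Metric.sphere (0 : H) 1 := by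
  have h0 : (0 : ℝ) ≤ 1 - ‖u‖ ^ 2 := by nlinarith [norm_nonneg u]
  have h : ‖(u : H) + √(1 - ‖u‖ ^ 2) • (x : H)‖ ^ 2 = 1 := by
    rw [norm_add_sq_real, inner_smul_right, real_inner_comm, inner_sphereTangent, norm_smul,
      norm_eq_of_mem_sphere, Real.norm_eq_abs, mul_one, sq_abs, Real.sq_sqrt h0]
    simp
  rw [mem_sphere_zero_iff_norm]
  nlinarith [norm_nonneg ((u : H) + √(1 - ‖u‖ ^ 2) • (x : H))]

open Classical in
/-- The projection chart of the unit sphere at `x`: it maps `{y | 0 < ⟪x, y⟫}` onto the open unit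
ball of the tangent space at `x` by orthogonal projection. -/
def sphereChart (x : Metric.sphere (0 : H) 1) :
    PartialEquiv (Metric.sphere (0 : H) 1) (SphereTangent x) where
  toFun y := sphereProj x y
  invFun u := if hu : ‖u‖ ≤ 1 then ⟨(u : H) + √(1 - ‖u‖ ^ 2) • (x : H), norm_spherePatch x u hu⟩
    else x
  source := {y | 0 < ⟪(x : H), (y : H)⟫}
  target := {u | ‖u‖ < 1}
  map_source' := by
    intro y hy
    have hy : 0 < ⟪(x : H), (y : H)⟫ := hy
    have h : ‖sphereProj x (y : H)‖ ^ 2 = 1 - ⟪(x : H), (y : H)⟫ ^ 2 := by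
      change ‖(y : H) - ⟪(x : H), (y : H)⟫ • (x : H)‖ ^ 2 = _
      rw [norm_sub_sq_real, inner_smul_right, real_inner_comm, norm_smul, norm_eq_of_mem_sphere,
        norm_eq_of_mem_sphere, Real.norm_eq_abs, mul_one, sq_abs]
      ring
    change ‖sphereProj x (y : H)‖ < 1
    nlinarith [norm_nonneg (sphereProj x (y : H)), pow_pos hy 2]
  map_target' := by
    intro u hu
    have hu : ‖u‖ < 1 := hu
    rw [dif_pos hu.le]
    change 0 < ⟪(x : H), (u : H) + √(1 - ‖u‖ ^ 2) • (x : H)⟫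
    rw [inner_add_right, inner_sphereTangent, inner_smul_right, inner_self_sphere, zero_add,
      mul_one]
    exact Real.sqrt_pos.2 (by nlinarith [norm_nonneg u])
  left_inv' := by
    intro y hy
    have hy : 0 < ⟪(x : H), (y : H)⟫ := hy
    have h : ‖sphereProj x (y : H)‖ ^ 2 = 1 - ⟪(x : H), (y : H)⟫ ^ 2 := by
      change ‖(y : H) - ⟪(x : H), (y : H)⟫ • (x : H)‖ ^ 2 = _
      rw [norm_sub_sq_real, inner_smul_right, real_inner_comm, norm_smul, norm_eq_of_mem_sphere,
        norm_eq_of_mem_sphere, Real.norm_eq_abs, mul_one, sq_abs]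
      ring
    have h1 : ‖sphereProj x (y : H)‖ ≤ 1 := by
      nlinarith [norm_nonneg (sphereProj x (y : H)), pow_pos hy 2]
    rw [dif_pos h1]
    ext
    change ((y : H) - ⟪(x : H), (y : H)⟫ • (x : H)) + _ = _
    rw [h, sub_sub_cancel, Real.sqrt_sq hy.le, sub_add_cancel]
  right_inv' := by
    intro u hu
    have hu : ‖u‖ < 1 := hu
    rw [dif_pos hu.le]
    ext
    change ((u : H) + √(1 - ‖u‖ ^ 2) • (x : H)) -
      ⟪(x : H), (u : H) + √(1 - ‖u‖ ^ 2) • (x : H)⟫ • (x : H) = u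
    rw [inner_add_right, inner_sphereTangent, inner_smul_right, inner_self_sphere, zero_add,
      mul_one, add_sub_cancel_right]

end Sphere

/-! ### Positive densities -/

variable {Ω : Type*} [MeasurableSpace Ω] {μ : Measure Ω}

/-- The set of probability densities with respect to `μ` that are positive `μ`-almost everywhere;
densities are identified if they agree `μ`-almost everywhere. -/
@[ext]
structure PosDensity (μ : Measure Ω) where
  toFun : Ω →ₘ[μ] ℝ
  pos : ∀ᵐ x ∂μ, 0 < toFun x
  integrable : Integrable toFun μ
  integral_eq_one : ∫ x, toFun x ∂μ = 1

namespace PosDensity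

/-- The probability measure `p · μ`; the expectation at `p` is the integral against it. -/
def measure (p : PosDensity μ) : Measure Ω := μ.withDensity fun x => ENNReal.ofReal (p.toFun x)

theorem absolutelyContinuous (p : PosDensity μ) : p.measure ≪ μ :=
  withDensity_absolutelyContinuous _ _

theorem ae_of_ae_measure (p : PosDensity μ) {P : Ω → Prop} (h : ∀ᵐ x ∂p.measure, P x) :
    ∀ᵐ x ∂μ, P x := by
  have hm : AEMeasurable (fun x => ENNReal.ofReal (p.toFun x)) μ :=
    p.toFun.aestronglyMeasurable.aemeasurable.ennreal_ofReal
  rw [measure, ae_withDensity_iff' hm] at h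
  filter_upwards [h, p.pos] with x hx hp
  exact hx (by simpa using hp)

theorem lintegral_eq_one (p : PosDensity μ) : ∫⁻ x, ENNReal.ofReal (p.toFun x) ∂μ = 1 := by
  rw [← ofReal_integral_eq_lintegral_ofReal p.integrable (p.pos.mono fun _ h => h.le),
    p.integral_eq_one, ENNReal.ofReal_one]

instance (p : PosDensity μ) : IsProbabilityMeasure p.measure :=
  ⟨by rw [measure, withDensity_apply _ MeasurableSet.univ, Measure.restrict_univ,
    p.lintegral_eq_one]⟩

theorem aemeasurable (p : PosDensity μ) (v : Ω →ₘ[μ] ℝ) : AEMeasurable v p.measure :=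
  v.aestronglyMeasurable.aemeasurable.mono_ac p.absolutelyContinuous

end PosDensity

/-! ### The exponential Orlicz space -/

/-- The Young function `Φ = cosh - 1`. -/
def youngPhi (x : ℝ) : ℝ := Real.cosh x - 1

theorem youngPhi_nonneg (x : ℝ) : 0 ≤ youngPhi x := sub_nonneg.2 (Real.one_le_cosh x)

theorem youngPhi_abs (x : ℝ) : youngPhi |x| = youngPhi x := by simp [youngPhi]

theorem youngPhi_convex : ConvexOn ℝ univ youngPhi := by
  have h1 : ConvexOn ℝ univ (fun x : ℝ => Real.exp (-x)) := by
    exact convexOn_exp.comp_linearMap (-LinearMap.id : ℝ →ₗ[ℝ] ℝ)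
  have h2 := ((convexOn_exp.add h1).smul (by norm_num : (0 : ℝ) ≤ 1 / 2)).add_const (-1)
  refine h2.congr fun x _ => ?_
  simp [youngPhi, Real.cosh_eq]
  ring

theorem youngPhi_mul_le {t : ℝ} (h0 : 0 ≤ t) (h1 : t ≤ 1) (x : ℝ) :
    youngPhi (t * x) ≤ t * youngPhi x := by
  have h := youngPhi_convex.2 (mem_univ x) (mem_univ 0) h0 (sub_nonneg.2 h1) (by ring)
  simpa [youngPhi] using h

theorem abs_le_youngPhi (x : ℝ) : |x| ≤ youngPhi x + 1 := by
  have h := Real.quadratic_le_exp_of_nonneg (abs_nonneg x)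
  have h' := Real.add_one_le_exp (-|x|)
  rw [← youngPhi_abs, youngPhi, Real.cosh_eq]
  nlinarith [sq_nonneg (|x| - 2), abs_nonneg x]

theorem measurable_youngPhi : Measurable youngPhi :=
  Real.measurable_cosh.sub_const 1

/-- `E_p[Φ(α v)]`. -/
def orliczModular (p : PosDensity μ) (α : ℝ) (v : Ω →ₘ[μ] ℝ) : ℝ≥0∞ :=
  ∫⁻ x, ENNReal.ofReal (youngPhi (α * v x)) ∂p.measure

theorem orliczModular_mul_le (p : PosDensity μ) {t : ℝ} (h0 : 0 ≤ t) (h1 : t ≤ 1) (α : ℝ)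
    (v : Ω →ₘ[μ] ℝ) :
    orliczModular p (t * α) v ≤ ENNReal.ofReal t * orliczModular p α v := by
  rw [orliczModular, orliczModular, ← lintegral_const_mul' _ _ ENNReal.ofReal_ne_top]
  refine lintegral_mono fun x => ?_
  rw [← ENNReal.ofReal_mul h0, mul_assoc]
  exact ENNReal.ofReal_le_ofReal (youngPhi_mul_le h0 h1 _)

theorem orliczModular_smul (p : PosDensity μ) (α c : ℝ) (v : Ω →ₘ[μ] ℝ) :
    orliczModular p α (c • v) = orliczModular p (α * |c|) v := by
  refine lintegral_congr_ae ?_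
  filter_upwards [p.absolutelyContinuous.ae_le (AEEqFun.coeFn_smul c v)] with x hx
  rw [hx, Pi.smul_apply, smul_eq_mul, ← youngPhi_abs, ← youngPhi_abs (α * |c| * _)]
  simp [abs_mul, mul_assoc]

theorem orliczModular_zero (p : PosDensity μ) (α : ℝ) :
    orliczModular p α (0 : Ω →ₘ[μ] ℝ) = 0 := by
  have h := orliczModular_smul p α 0 (0 : Ω →ₘ[μ] ℝ)
  rw [zero_smul] at h
  rw [h]
  simp [orliczModular, youngPhi]

theorem orliczModular_add_le (p : PosDensity μ) {r s : ℝ} (hr : 0 < r) (hs : 0 < s)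
    (v w : Ω →ₘ[μ] ℝ) :
    orliczModular p (r + s)⁻¹ (v + w) ≤
      ENNReal.ofReal (r / (r + s)) * orliczModular p r⁻¹ v +
        ENNReal.ofReal (s / (r + s)) * orliczModular p s⁻¹ w := by
  have hrs : 0 < r + s := add_pos hr hs
  have hm : AEMeasurable (fun x => ENNReal.ofReal (r / (r + s)) *
      ENNReal.ofReal (youngPhi (r⁻¹ * v x))) p.measure :=
    (measurable_youngPhi.comp_aemeasurable
      ((p.aemeasurable v).const_mul _)).ennreal_ofReal.const_mul _
  rw [orliczModular, orliczModular, orliczModular, ← lintegral_const_mul' _ _ ENNReal.ofReal_ne_top,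
    ← lintegral_const_mul' _ _ ENNReal.ofReal_ne_top, ← lintegral_add_left' hm]
  refine lintegral_mono_ae ?_
  filter_upwards [p.absolutelyContinuous.ae_le (AEEqFun.coeFn_add v w)] with x hx
  rw [← ENNReal.ofReal_mul (by positivity), ← ENNReal.ofReal_mul (by positivity),
    ← ENNReal.ofReal_add (mul_nonneg (by positivity) (youngPhi_nonneg _))
      (mul_nonneg (by positivity) (youngPhi_nonneg _))]
  refine ENNReal.ofReal_le_ofReal ?_
  have h := youngPhi_convex.2 (mem_univ (r⁻¹ * v x)) (mem_univ (s⁻¹ * w x))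
    (by positivity : 0 ≤ r / (r + s)) (by positivity : 0 ≤ s / (r + s)) (by field_simp)
  have e : (r + s)⁻¹ * (v + w : Ω →ₘ[μ] ℝ) x =
      (r / (r + s)) • (r⁻¹ * v x) + (s / (r + s)) • (s⁻¹ * w x) := by
    rw [hx, Pi.add_apply, smul_eq_mul, smul_eq_mul]
    field_simp
  rw [e]
  exact h

/-- The exponential Orlicz space `L^Φ(p)`, `Φ = cosh - 1`: the (classes of) random variables `v`
with `E_p[Φ(α v)] < ∞` for some `α > 0`. -/
def OrliczSpace (p : PosDensity μ) : Submodule ℝ (Ω →ₘ[μ] ℝ) where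
  carrier := {v | ∃ α : ℝ, 0 < α ∧ orliczModular p α v < ⊤}
  zero_mem' := ⟨1, one_pos, by rw [orliczModular_zero]; exact ENNReal.zero_lt_top⟩
  add_mem' := by
    rintro v w ⟨α, hα, hv⟩ ⟨β, hβ, hw⟩
    refine ⟨(α⁻¹ + β⁻¹)⁻¹, by positivity,
      (orliczModular_add_le p (inv_pos.2 hα) (inv_pos.2 hβ) v w).trans_lt ?_⟩
    rw [inv_inv, inv_inv]
    exact ENNReal.add_lt_top.2
      ⟨ENNReal.mul_lt_top ENNReal.ofReal_lt_top hv, ENNReal.mul_lt_top ENNReal.ofReal_lt_top hw⟩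
  smul_mem' := by
    rintro c v ⟨α, hα, hv⟩
    rcases eq_or_ne c 0 with rfl | hc
    · refine ⟨1, one_pos, ?_⟩
      rw [zero_smul, orliczModular_zero]
      exact ENNReal.zero_lt_top
    · have hc' : 0 < |c| := abs_pos.2 hc
      refine ⟨α / |c|, by positivity, ?_⟩
      rw [orliczModular_smul, div_mul_cancel₀ _ hc'.ne']
      exact hv

/-- The Luxemburg norm: its closed unit ball is `{v | E_p[Φ(v)] ≤ 1}`. -/
def luxemburgNorm (p : PosDensity μ) (v : Ω →ₘ[μ] ℝ) : ℝ :=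
  sInf {r : ℝ | 0 < r ∧ orliczModular p r⁻¹ v ≤ 1}

theorem luxemburgNorm_nonneg (p : PosDensity μ) (v : Ω →ₘ[μ] ℝ) : 0 ≤ luxemburgNorm p v :=
  Real.sInf_nonneg fun _ h => h.1.le

theorem luxemburgNorm_le (p : PosDensity μ) {v : Ω →ₘ[μ] ℝ} {r : ℝ} (hr : 0 < r)
    (h : orliczModular p r⁻¹ v ≤ 1) : luxemburgNorm p v ≤ r :=
  csInf_le ⟨0, fun _ h => h.1.le⟩ ⟨hr, h⟩

theorem luxemburg_nonempty (p : PosDensity μ) {v : Ω →ₘ[μ] ℝ} (hv : v ∈ OrliczSpace p) :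
    {r : ℝ | 0 < r ∧ orliczModular p r⁻¹ v ≤ 1}.Nonempty := by
  obtain ⟨α, hα, h⟩ := hv
  set m := (orliczModular p α v).toReal with hm
  have hm0 : 0 ≤ m := ENNReal.toReal_nonneg
  refine ⟨((1 + m)⁻¹ * α)⁻¹, by positivity, ?_⟩
  rw [inv_inv]
  refine (orliczModular_mul_le p (by positivity) (inv_le_one_of_one_le₀ (by linarith)) α v).trans ?_
  rw [← ENNReal.ofReal_toReal (ne_of_lt h), ← hm, ← ENNReal.ofReal_mul (by positivity)]
  refine ENNReal.ofReal_le_one.2 ?_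
  rw [inv_mul_le_iff₀ (by positivity)]
  linarith

theorem luxemburgNorm_zero (p : PosDensity μ) : luxemburgNorm p (0 : Ω →ₘ[μ] ℝ) = 0 := by
  refine le_antisymm (le_of_forall_pos_le_add fun ε hε => ?_) (luxemburgNorm_nonneg p _)
  rw [zero_add]
  exact luxemburgNorm_le p hε (by rw [orliczModular_zero]; exact zero_le_one)

theorem luxemburgNorm_smul_le (p : PosDensity μ) {v : Ω →ₘ[μ] ℝ} (hv : v ∈ OrliczSpace p) (c : ℝ) :
    luxemburgNorm p (c • v) ≤ |c| * luxemburgNorm p v := by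
  rcases eq_or_ne c 0 with rfl | hc
  · rw [zero_smul, luxemburgNorm_zero, abs_zero, zero_mul]
  · have hc' : 0 < |c| := abs_pos.2 hc
    rw [← div_le_iff₀' hc']
    refine le_csInf (luxemburg_nonempty p hv) fun r hr => ?_
    rw [div_le_iff₀' hc']
    refine luxemburgNorm_le p (mul_pos hc' hr.1) ?_
    rw [orliczModular_smul, mul_inv_rev, inv_mul_cancel_right₀ hc'.ne']
    exact hr.2

theorem luxemburgNorm_smul (p : PosDensity μ) {v : Ω →ₘ[μ] ℝ} (hv : v ∈ OrliczSpace p) (c : ℝ) :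
    luxemburgNorm p (c • v) = |c| * luxemburgNorm p v := by
  refine le_antisymm (luxemburgNorm_smul_le p hv c) ?_
  rcases eq_or_ne c 0 with rfl | hc
  · rw [abs_zero, zero_mul]; exact luxemburgNorm_nonneg p _
  · have h := luxemburgNorm_smul_le p ((OrliczSpace p).smul_mem c hv) c⁻¹
    rw [inv_smul_smul₀ hc, abs_inv] at h
    rwa [le_inv_mul_iff₀ (abs_pos.2 hc)] at h

theorem luxemburgNorm_add_le (p : PosDensity μ) {v w : Ω →ₘ[μ] ℝ} (hv : v ∈ OrliczSpace p)
    (hw : w ∈ OrliczSpace p) :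
    luxemburgNorm p (v + w) ≤ luxemburgNorm p v + luxemburgNorm p w := by
  rw [← sub_le_iff_le_add]
  refine le_csInf (luxemburg_nonempty p hv) fun r hr => ?_
  rw [sub_le_comm]
  refine le_csInf (luxemburg_nonempty p hw) fun s hs => ?_
  rw [sub_le_iff_le_add']
  have hrs : 0 < r + s := add_pos hr.1 hs.1
  refine luxemburgNorm_le p hrs ((orliczModular_add_le p hr.1 hs.1 v w).trans ?_)
  calc _ ≤ ENNReal.ofReal (r / (r + s)) * 1 + ENNReal.ofReal (s / (r + s)) * 1 := by
        gcongr
        exacts [hr.2, hs.2]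
    _ = 1 := by
        rw [mul_one, mul_one, ← ENNReal.ofReal_add (div_nonneg hr.1.le hrs.le)
          (div_nonneg hs.1.le hrs.le), ← add_div, div_self hrs.ne', ENNReal.ofReal_one]

theorem lintegral_abs_le (p : PosDensity μ) {r : ℝ} (hr : 0 < r) {v : Ω →ₘ[μ] ℝ} :
    ∫⁻ x, ENNReal.ofReal |v x| ∂p.measure ≤
      ENNReal.ofReal r * (orliczModular p r⁻¹ v + 1) := by
  have h1 : (1 : ℝ≥0∞) = ∫⁻ _, 1 ∂p.measure := by simp
  rw [orliczModular, h1, ← lintegral_add_right _ measurable_const,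
    ← lintegral_const_mul' _ _ ENNReal.ofReal_ne_top]
  refine lintegral_mono fun x => ?_
  rw [← ENNReal.ofReal_one, ← ENNReal.ofReal_add (youngPhi_nonneg _) zero_le_one,
    ← ENNReal.ofReal_mul hr.le]
  refine ENNReal.ofReal_le_ofReal ?_
  have h := mul_le_mul_of_nonneg_left (abs_le_youngPhi (r⁻¹ * v x)) hr.le
  rwa [abs_mul, abs_of_pos (inv_pos.2 hr), mul_inv_cancel_left₀ hr.ne'] at h

theorem eq_zero_of_luxemburgNorm (p : PosDensity μ) {v : Ω →ₘ[μ] ℝ} (hv : v ∈ OrliczSpace p)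
    (h : luxemburgNorm p v = 0) : v = 0 := by
  have key : ∀ ε : ℝ, 0 < ε → ∫⁻ x, ENNReal.ofReal |v x| ∂p.measure ≤ ENNReal.ofReal (2 * ε) := by
    intro ε hε
    obtain ⟨r, hr, hrε⟩ := exists_lt_of_csInf_lt (luxemburg_nonempty p hv)
      (show sInf {r : ℝ | 0 < r ∧ orliczModular p r⁻¹ v ≤ 1} < ε by
        rw [← luxemburgNorm, h]; exact hε)
    refine (lintegral_abs_le p hr.1).trans ?_
    calc _ ≤ ENNReal.ofReal r * (1 + 1) := by gcongr; exact hr.2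
      _ = ENNReal.ofReal (2 * r) := by
          rw [mul_comm, ENNReal.ofReal_mul zero_le_two, one_add_one_eq_two, ENNReal.ofReal_ofNat]
      _ ≤ _ := ENNReal.ofReal_le_ofReal (by linarith)
  have h0 : ∫⁻ x, ENNReal.ofReal |v x| ∂p.measure = 0 := by
    refine le_antisymm (ENNReal.le_of_forall_pos_le_add fun ε hε _ => ?_) zero_le
    have := key (ε / 2) (by positivity)
    rw [mul_div_cancel₀ _ two_ne_zero, ENNReal.ofReal_coe_nnreal] at this
    rwa [zero_add]
  have hm : AEMeasurable (fun x => ENNReal.ofReal |v x|) p.measure :=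
    (measurable_norm.comp_aemeasurable (p.aemeasurable v)).ennreal_ofReal
  rw [lintegral_eq_zero_iff' hm] at h0
  refine AEEqFun.ext ?_
  filter_upwards [p.ae_of_ae_measure h0, AEEqFun.coeFn_zero (α := Ω) (β := ℝ) (μ := μ)] with x hx h0
  rw [h0]
  simpa using hx

instance (p : PosDensity μ) : Norm (OrliczSpace p) := ⟨fun v => luxemburgNorm p v⟩

theorem orlicz_core (p : PosDensity μ) : NormedSpace.Core ℝ (OrliczSpace p) where
  norm_nonneg v := luxemburgNorm_nonneg p v
  norm_smul c v := luxemburgNorm_smul p v.2 c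
  norm_triangle v w := luxemburgNorm_add_le p v.2 w.2
  norm_eq_zero_iff v := ⟨fun h => Subtype.ext (eq_zero_of_luxemburgNorm p v.2 h), by
    rintro rfl; exact luxemburgNorm_zero p⟩

instance (p : PosDensity μ) : NormedAddCommGroup (OrliczSpace p) :=
  NormedAddCommGroup.ofCore (orlicz_core p)

instance (p : PosDensity μ) : NormedSpace ℝ (OrliczSpace p) :=
  NormedSpace.ofCore (orlicz_core p)

theorem integrable_orlicz (p : PosDensity μ) {v : Ω →ₘ[μ] ℝ} (hv : v ∈ OrliczSpace p) :
    Integrable v p.measure := by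
  obtain ⟨α, hα, h⟩ := hv
  refine ⟨(p.aemeasurable v).aestronglyMeasurable, ?_⟩
  have h2 := lintegral_abs_le p (inv_pos.2 hα) (v := v)
  rw [inv_inv] at h2
  rw [hasFiniteIntegral_iff_norm]
  exact h2.trans_lt (ENNReal.mul_lt_top ENNReal.ofReal_lt_top
    (ENNReal.add_lt_top.2 ⟨h, ENNReal.one_lt_top⟩))

/-- The model space `B_p` of the `p`-centered elements of `L^Φ(p)`, with the Luxemburg norm. It is
also the tangent space of the exponential manifold at `p`. -/
def CenteredSpace (p : PosDensity μ) : Submodule ℝ (OrliczSpace p) where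
  carrier := {v | ∫ x, (v : Ω →ₘ[μ] ℝ) x ∂p.measure = 0}
  zero_mem' := by
    change ∫ x, (0 : Ω →ₘ[μ] ℝ) x ∂p.measure = 0
    rw [integral_congr_ae (p.absolutelyContinuous.ae_le AEEqFun.coeFn_zero)]
    simp
  add_mem' := by
    intro v w hv hw
    have hv : ∫ x, (v : Ω →ₘ[μ] ℝ) x ∂p.measure = 0 := hv
    have hw : ∫ x, (w : Ω →ₘ[μ] ℝ) x ∂p.measure = 0 := hw
    change ∫ x, ((v : Ω →ₘ[μ] ℝ) + (w : Ω →ₘ[μ] ℝ)) x ∂p.measure = 0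
    rw [integral_congr_ae (p.absolutelyContinuous.ae_le (AEEqFun.coeFn_add _ _)),
      integral_add' (integrable_orlicz p v.2) (integrable_orlicz p w.2), hv, hw, add_zero]
  smul_mem' := by
    intro c v hv
    have hv : ∫ x, (v : Ω →ₘ[μ] ℝ) x ∂p.measure = 0 := hv
    change ∫ x, (c • (v : Ω →ₘ[μ] ℝ)) x ∂p.measure = 0
    rw [integral_congr_ae (p.absolutelyContinuous.ae_le (AEEqFun.coeFn_smul _ _))]
    simp only [Pi.smul_apply, integral_smul, hv, smul_zero]

/-- The random variable underlying an element of `B_p`. -/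
def rv {p : PosDensity μ} (u : CenteredSpace p) : Ω →ₘ[μ] ℝ :=
  ((u : OrliczSpace p) : Ω →ₘ[μ] ℝ)

/-! ### The exponential charts -/

/-- The moment generating functional `M_p(u) = E_p[exp u]`. -/
def momentGen (p : PosDensity μ) (u : CenteredSpace p) : ℝ≥0∞ :=
  ∫⁻ x, ENNReal.ofReal (Real.exp (rv u x)) ∂p.measure

/-- The cumulant generating functional `K_p(u) = log E_p[exp u]`, possibly `+∞`. -/
def cumulantGen (p : PosDensity μ) (u : CenteredSpace p) : EReal := ENNReal.log (momentGen p u)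

/-- `𝒮_p`: the interior, in `B_p`, of the proper domain of `K_p`. -/
def expDomain (p : PosDensity μ) : Set (CenteredSpace p) := interior {u | cumulantGen p u < ⊤}

theorem aemeasurable_exp (p : PosDensity μ) (u : CenteredSpace p) :
    AEMeasurable (fun x => ENNReal.ofReal (Real.exp (rv u x))) p.measure :=
  (Real.measurable_exp.comp_aemeasurable (p.aemeasurable _)).ennreal_ofReal

theorem momentGen_ne_zero (p : PosDensity μ) (u : CenteredSpace p) : momentGen p u ≠ 0 := by
  intro h
  rw [momentGen, lintegral_eq_zero_iff' (aemeasurable_exp p u)] at h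
  have h' : ∀ᵐ _ ∂p.measure, False := by
    filter_upwards [h] with x hx
    exact absurd hx (by simpa using Real.exp_pos _)
  rw [Filter.eventually_false_iff_eq_bot, ae_eq_bot] at h'
  exact IsProbabilityMeasure.ne_zero p.measure h'

theorem momentGen_ne_top {p : PosDensity μ} {u : CenteredSpace p} (hu : u ∈ expDomain p) :
    momentGen p u ≠ ⊤ := by
  have h : cumulantGen p u < ⊤ := interior_subset (s := {u | cumulantGen p u < ⊤}) hu
  intro h'
  rw [cumulantGen, h', ENNReal.log_top] at h
  exact lt_irrefl _ h

theorem exp_cumulantGen {p : PosDensity μ} {u : CenteredSpace p} (hu : u ∈ expDomain p) :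
    Real.exp (cumulantGen p u).toReal = (momentGen p u).toReal := by
  rw [cumulantGen, ENNReal.log_pos_real (momentGen_ne_zero p u) (momentGen_ne_top hu),
    EReal.toReal_coe,
    Real.exp_log (ENNReal.toReal_pos (momentGen_ne_zero p u) (momentGen_ne_top hu))]

theorem aestronglyMeasurable_patch (p : PosDensity μ) (u : CenteredSpace p) (k : ℝ) :
    AEStronglyMeasurable (fun x => Real.exp (rv u x - k) * p.toFun x) μ :=
  ((Real.measurable_exp.comp_aemeasurable
    ((rv u).aestronglyMeasurable.aemeasurable.sub_const k)).mul
      p.toFun.aestronglyMeasurable.aemeasurable).aestronglyMeasurable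

theorem lintegral_patch {p : PosDensity μ} {u : CenteredSpace p} (hu : u ∈ expDomain p) :
    ∫⁻ x, ENNReal.ofReal (Real.exp (rv u x - (cumulantGen p u).toReal) * p.toFun x) ∂μ = 1 := by
  have hm : momentGen p u = ∫⁻ x, ENNReal.ofReal (p.toFun x) *
      ENNReal.ofReal (Real.exp (rv u x)) ∂μ := by
    rw [momentGen, PosDensity.measure, lintegral_withDensity_eq_lintegral_mul₀
      p.toFun.aestronglyMeasurable.aemeasurable.ennreal_ofReal]
    · rfl
    · exact (Real.measurable_exp.comp_aemeasurable
        (rv u).aestronglyMeasurable.aemeasurable).ennreal_ofReal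
  have h : ∀ x, ENNReal.ofReal (Real.exp (rv u x - (cumulantGen p u).toReal) * p.toFun x) =
      (momentGen p u)⁻¹ * (ENNReal.ofReal (p.toFun x) * ENNReal.ofReal (Real.exp (rv u x))) := by
    intro x
    rw [Real.exp_sub, exp_cumulantGen hu, div_mul_eq_mul_div, mul_comm,
      ENNReal.ofReal_div_of_pos (ENNReal.toReal_pos (momentGen_ne_zero p u) (momentGen_ne_top hu)),
      ENNReal.ofReal_toReal (momentGen_ne_top hu), ENNReal.ofReal_mul' (Real.exp_pos _).le,
      ENNReal.div_eq_inv_mul]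
  simp_rw [h]
  rw [lintegral_const_mul' _ _ (ENNReal.inv_ne_top.2 (momentGen_ne_zero p u)), ← hm,
    ENNReal.inv_mul_cancel (momentGen_ne_zero p u) (momentGen_ne_top hu)]

theorem patch_pos (p : PosDensity μ) (u : CenteredSpace p) (k : ℝ) :
    ∀ᵐ x ∂μ, 0 < Real.exp (rv u x - k) * p.toFun x :=
  p.pos.mono fun _ h => mul_pos (Real.exp_pos _) h

/-- The patch `e_p : 𝒮_p → 𝓜`, `e_p(u) = exp(u - K_p(u)) · p`. -/
def expPatch (p : PosDensity μ) (u : expDomain p) : PosDensity μ where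
  toFun := AEEqFun.mk
    (fun x => Real.exp (rv u.1 x - (cumulantGen p u.1).toReal) * p.toFun x)
    (aestronglyMeasurable_patch p u.1 _)
  pos := by
    filter_upwards [AEEqFun.coeFn_mk _ (aestronglyMeasurable_patch p u.1 _), patch_pos p u.1 _]
      with x hx h
    rw [hx]
    exact h
  integrable := by
    refine (integrable_congr (AEEqFun.coeFn_mk _ _)).2 ⟨aestronglyMeasurable_patch p u.1 _, ?_⟩
    rw [hasFiniteIntegral_iff_ofReal ((patch_pos p u.1 _).mono fun _ h => h.le),
      lintegral_patch u.2]
    exact ENNReal.one_lt_top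
  integral_eq_one := by
    rw [integral_congr_ae (AEEqFun.coeFn_mk _ _), integral_eq_lintegral_of_nonneg_ae
      ((patch_pos p u.1 _).mono fun _ h => h.le) (aestronglyMeasurable_patch p u.1 _),
      lintegral_patch u.2, ENNReal.toReal_one]

/-- The maximal exponential model `ℰ(p) = {exp(u - K_p(u)) · p | u ∈ 𝒮_p}`. -/
def maxExpModel (p : PosDensity μ) : Set (PosDensity μ) := range (expPatch p)

theorem aestronglyMeasurable_logRatio (p q : PosDensity μ) (c : ℝ) :
    AEStronglyMeasurable (fun x => Real.log (q.toFun x / p.toFun x) - c) μ :=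
  ((Real.measurable_log.comp_aemeasurable (q.toFun.aestronglyMeasurable.aemeasurable.div
    p.toFun.aestronglyMeasurable.aemeasurable)).sub_const c).aestronglyMeasurable

/-- `log (q / p) - E_p[log (q / p)]`. -/
def centeredLogRatio (p q : PosDensity μ) : Ω →ₘ[μ] ℝ :=
  AEEqFun.mk (fun x => Real.log (q.toFun x / p.toFun x) -
    ∫ y, Real.log (q.toFun y / p.toFun y) ∂p.measure) (aestronglyMeasurable_logRatio p q _)

theorem centeredLogRatio_patch (p : PosDensity μ) (u : expDomain p) :
    centeredLogRatio p (expPatch p u) = rv u.1 := by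
  have h : ∀ᵐ x ∂μ, Real.log ((expPatch p u).toFun x / p.toFun x) =
      rv u.1 x - (cumulantGen p u.1).toReal := by
    filter_upwards [AEEqFun.coeFn_mk _ (aestronglyMeasurable_patch p u.1
      (cumulantGen p u.1).toReal), p.pos] with x hx hp
    change Real.log ((AEEqFun.mk _ (aestronglyMeasurable_patch p u.1
      (cumulantGen p u.1).toReal) : Ω →ₘ[μ] ℝ) x / _) = _
    rw [hx, mul_div_cancel_right₀ _ hp.ne', Real.log_exp]
  have hc : ∫ x, rv u.1 x ∂p.measure = 0 := u.1.2
  have hi : ∫ y, Real.log ((expPatch p u).toFun y / p.toFun y) ∂p.measure =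
      -(cumulantGen p u.1).toReal := by
    have hint : Integrable (rv u.1) p.measure := integrable_orlicz p u.1.1.2
    rw [integral_congr_ae (p.absolutelyContinuous.ae_le h),
      integral_sub hint (integrable_const _), hc]
    simp
  refine AEEqFun.ext ?_
  filter_upwards [AEEqFun.coeFn_mk _ (aestronglyMeasurable_logRatio p (expPatch p u)
    (∫ y, Real.log ((expPatch p u).toFun y / p.toFun y) ∂p.measure)), h] with x hx hx'
  rw [centeredLogRatio, hx, hx', hi]
  ring

open Classical in
/-- The map `q ↦ log (q / p) - E_p[log (q / p)]` with values in `B_p`, extended by the value `0` to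
the densities `q` for which this random variable is not in `B_p`. -/
def expChartFun (p q : PosDensity μ) : CenteredSpace p :=
  if h : ∃ v : CenteredSpace p, rv v = centeredLogRatio p q then h.choose else 0

theorem expChartFun_patch (p : PosDensity μ) (u : expDomain p) :
    expChartFun p (expPatch p u) = u.1 := by
  have h : ∃ v : CenteredSpace p, rv v = centeredLogRatio p (expPatch p u) :=
    ⟨u.1, (centeredLogRatio_patch p u).symm⟩
  rw [expChartFun, dif_pos h]
  exact Subtype.ext (Subtype.ext (h.choose_spec.trans (centeredLogRatio_patch p u)))

open Classical in
/-- The chart `s_p : ℰ(p) → 𝒮_p` of the exponential manifold, with inverse `e_p`. -/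
def expChart (p : PosDensity μ) : PartialEquiv (PosDensity μ) (CenteredSpace p) where
  toFun := expChartFun p
  invFun u := if hu : u ∈ expDomain p then expPatch p ⟨u, hu⟩ else p
  source := maxExpModel p
  target := expDomain p
  map_source' := by
    rintro _ ⟨u, rfl⟩
    rw [expChartFun_patch]
    exact u.2
  map_target' := by
    intro u hu
    rw [dif_pos hu]
    exact mem_range_self _
  left_inv' := by
    rintro _ ⟨u, rfl⟩
    rw [expChartFun_patch, dif_pos u.2]
  right_inv' := by
    intro u hu
    rw [dif_pos hu]
    exact expChartFun_patch p ⟨u, hu⟩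

/-! ### The square root embedding -/

theorem memLp_sqrt (p : PosDensity μ) : MemLp (fun x => √(p.toFun x)) 2 μ := by
  have hm : AEStronglyMeasurable (fun x => √(p.toFun x)) μ :=
    (Real.continuous_sqrt.measurable.comp_aemeasurable
      p.toFun.aestronglyMeasurable.aemeasurable).aestronglyMeasurable
  rw [memLp_two_iff_integrable_sq hm]
  exact p.integrable.congr (p.pos.mono fun x h => (Real.sq_sqrt h.le).symm)

/-- The map `𝓜 → S`, `p ↦ √p`, into the unit sphere `S` of `L²(μ)`. -/
def sqrtMap (p : PosDensity μ) : Metric.sphere (0 : Lp ℝ 2 μ) 1 :=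
  ⟨(memLp_sqrt p).toLp _, by
    have h : ‖(memLp_sqrt p).toLp _‖ ^ 2 = 1 := by
      rw [← real_inner_self_eq_norm_sq, L2.inner_def, ← p.integral_eq_one]
      refine integral_congr_ae ?_
      filter_upwards [(memLp_sqrt p).coeFn_toLp, p.pos] with x hx hp
      rw [hx]
      simp [Real.sq_sqrt hp.le]
    rw [mem_sphere_zero_iff_norm]
    nlinarith [norm_nonneg ((memLp_sqrt p).toLp _)]⟩

end ExpManifold

end

noncomputable section

namespace ExpManifold

variable {Ω : Type*} [MeasurableSpace Ω] {μ : Measure Ω}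

/-! ### Uniform exponential moments -/

/-! In the chart at `p` the map is `u ↦ exp(-K_p(u)/2) F(u)` with `F(u) = exp(u/2) √p`. Its values
are unit vectors and the scalar is positive, so the map equals `F/‖F‖` (`sqrtMap_symm_eq`);
regularity of `K_p` is never needed. It remains to study `F` as a map from `𝒮_p` to `L²(μ)`.

`F` is analytic on `𝒮_p` (`exists_hasFPowerSeriesAt_sqrtExp`): the expansion of `F(u + y)` has the
terms `(y/2)^n/n! · exp(u/2) √p`. Convergence rests on the bound `‖h₁⋯hₙ exp(u/2) √p‖₂ ≤ B n! R^n
∏‖hᵢ‖` of `exists_eLpNorm_expTerm_le`. The squared norm is `E_p[(h₁⋯hₙ)² e^u]`. Since `𝒮_p` is open,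
`a u ∈ 𝒮_p` for some `a > 1`, and convexity of `exp` trades this surplus for a uniform bound on
`E_p[exp(u + 2c|h|)]` over the unit ball. Elementary inequalities reduce the product to such
moments.

At `0` the derivative of `F` is `w ↦ ½ w √p`. It is orthogonal to `F(0) = √p` because `E_p[w] = 0`,
so normalizing does not change it. The sphere charts are restrictions of continuous linear
projections, which preserve smoothness and fix these tangent vectors. -/

theorem coeFn_rv_add {p : PosDensity μ} (u v : CenteredSpace p) :
    rv (u + v) =ᵐ[μ] fun x => rv u x + rv v x :=
  AEEqFun.coeFn_add (rv u) (rv v)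

theorem coeFn_rv_smul {p : PosDensity μ} (c : ℝ) (u : CenteredSpace p) :
    rv (c • u) =ᵐ[μ] fun x => c * rv u x :=
  AEEqFun.coeFn_smul c (rv u)

theorem coeFn_rv_zero {p : PosDensity μ} : rv (0 : CenteredSpace p) =ᵐ[μ] fun _ => 0 :=
  AEEqFun.coeFn_zero

/-- The strict inequality provides an admissible radius `s < r`, so it need not be known that the
infimum is attained; `Φ(tx) ≤ tΦ(x)` with `t = s/r` then passes from `s` to `r`. -/
theorem orliczModular_inv_le_one {p : PosDensity μ} {v : CenteredSpace p} {r : ℝ}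
    (h : ‖v‖ < r) : orliczModular p r⁻¹ (rv v) ≤ 1 := by
  obtain ⟨s, hs, hsr⟩ := exists_lt_of_csInf_lt (luxemburg_nonempty p v.1.2)
    (show sInf {r : ℝ | 0 < r ∧ orliczModular p r⁻¹ (rv v) ≤ 1} < r from h)
  have hr : 0 < r := hs.1.trans hsr
  have e : r⁻¹ = s / r * s⁻¹ := by have := hs.1; field_simp
  rw [e]
  refine (orliczModular_mul_le p (div_nonneg hs.1.le hr.le) ((div_le_one hr).2 hsr.le) _ _).trans ?_
  exact mul_le_one' (ENNReal.ofReal_le_one.2 ((div_le_one hr).2 hsr.le)) hs.2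

theorem exp_abs_le_youngPhi (x : ℝ) : Real.exp |x| ≤ 2 * (youngPhi x + 1) := by
  rw [← youngPhi_abs, youngPhi, Real.cosh_eq]
  linarith [Real.exp_pos (-|x|)]

theorem lintegral_exp_abs_le {p : PosDensity μ} {v : CenteredSpace p} {r : ℝ} (h : ‖v‖ < r) :
    ∫⁻ x, ENNReal.ofReal (Real.exp |r⁻¹ * rv v x|) ∂p.measure ≤ 4 := by
  have h1 : (1 : ℝ≥0∞) = ∫⁻ _, 1 ∂p.measure := by simp
  calc _ ≤ ∫⁻ x, 2 * (ENNReal.ofReal (youngPhi (r⁻¹ * rv v x)) + 1) ∂p.measure := by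
        refine lintegral_mono fun x => ?_
        rw [← ENNReal.ofReal_one, ← ENNReal.ofReal_add (youngPhi_nonneg _) zero_le_one,
          ← ENNReal.ofReal_ofNat, ← ENNReal.ofReal_mul zero_le_two]
        exact ENNReal.ofReal_le_ofReal (exp_abs_le_youngPhi _)
    _ = 2 * (orliczModular p r⁻¹ (rv v) + 1) := by
        rw [lintegral_const_mul' _ _ ENNReal.ofNat_ne_top, lintegral_add_right _ measurable_const,
          ← h1, orliczModular]
    _ ≤ 2 * (1 + 1) := by gcongr; exact orliczModular_inv_le_one h
    _ = 4 := by norm_num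

theorem cumulantGen_lt_top_iff {p : PosDensity μ} {u : CenteredSpace p} :
    cumulantGen p u < ⊤ ↔ momentGen p u < ⊤ := by
  rw [cumulantGen, lt_top_iff_ne_top, lt_top_iff_ne_top, Ne, ENNReal.log_eq_top_iff]

theorem isOpen_expDomain (p : PosDensity μ) : IsOpen (expDomain p) := isOpen_interior

theorem zero_mem_expDomain (p : PosDensity μ) : (0 : CenteredSpace p) ∈ expDomain p := by
  rw [expDomain, mem_interior_iff_mem_nhds]
  filter_upwards [Metric.ball_mem_nhds (0 : CenteredSpace p) one_pos] with u hu
  rw [mem_ball_zero_iff] at hu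
  refine cumulantGen_lt_top_iff.2 (lt_of_le_of_lt ?_ (ENNReal.ofNat_lt_top (n := 4)))
  refine (lintegral_mono fun x => ?_).trans (lintegral_exp_abs_le hu)
  refine ENNReal.ofReal_le_ofReal (Real.exp_le_exp.2 ?_)
  rw [inv_one, one_mul]
  exact le_abs_self _

/-- Openness along the ray through `u` gives `e^u` integrability of some order above one, the room
needed to absorb polynomial and small exponential factors. -/
theorem exists_one_lt_smul_mem_expDomain {p : PosDensity μ} {u : CenteredSpace p}
    (hu : u ∈ expDomain p) : ∃ a : ℝ, 1 < a ∧ a • u ∈ expDomain p := by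
  have hc : Filter.Tendsto (fun a : ℝ => a • u) (𝓝 1) (𝓝 u) := by
    have : Continuous fun a : ℝ => a • u := by fun_prop
    simpa using this.tendsto 1
  have h := (hc ((isOpen_expDomain p).mem_nhds hu))
  have h' : ∀ᶠ a in 𝓝[>] (1 : ℝ), a • u ∈ expDomain p := nhdsWithin_le_nhds h
  obtain ⟨a, ha, ha'⟩ := (h'.and self_mem_nhdsWithin).exists
  exact ⟨a, ha', ha⟩

/-- On the domain `𝒮_p`, the exponential moments `E_p[exp (u + c |h|)]` are bounded uniformly for
`h` in the unit ball. -/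
theorem exists_lintegral_exp_add_le {p : PosDensity μ} {u : CenteredSpace p}
    (hu : u ∈ expDomain p) : ∃ c : ℝ, 0 < c ∧ ∃ C : ℝ≥0∞, C ≠ ⊤ ∧ ∀ h : CenteredSpace p, ‖h‖ ≤ 1 →
      ∫⁻ x, ENNReal.ofReal (Real.exp (rv u x + 2 * c * |rv h x|)) ∂p.measure ≤ C := by
  obtain ⟨a, ha, hau⟩ := exists_one_lt_smul_mem_expDomain hu
  have ha0 : 0 < a := one_pos.trans ha
  set t : ℝ := 1 - a⁻¹ with ht
  have ht0 : 0 < t := sub_pos.2 (inv_lt_one_of_one_lt₀ ha)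
  -- With `c = t/4`, the perturbation `2c|h|` is `t · |h/2|`. Halving `h` gives `‖h‖ < 2`, the
  -- strict inequality that the bound by `4` requires.
  refine ⟨t / 4, by positivity, momentGen p (a • u) + 4,
    ENNReal.add_ne_top.2 ⟨momentGen_ne_top hau, ENNReal.ofNat_ne_top⟩, fun h hh => ?_⟩
  refine le_trans ?_ (add_le_add_right (lintegral_exp_abs_le (hh.trans_lt one_lt_two)) _)
  rw [momentGen, ← lintegral_add_left' (aemeasurable_exp p _)]
  refine lintegral_mono_ae ?_
  filter_upwards [p.absolutelyContinuous.ae_le (coeFn_rv_smul a u)] with x hx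
  rw [← ENNReal.ofReal_add (Real.exp_pos _).le (Real.exp_pos _).le, hx]
  refine ENNReal.ofReal_le_ofReal ?_
  -- Convexity with weights `a⁻¹ + t = 1` separates `u` from `h`: a convex combination of
  -- exponentials replaces the product, so no Hölder inequality is needed.
  have hconv := convexOn_exp.2 (mem_univ (a * rv u x)) (mem_univ |2⁻¹ * rv h x|)
    (inv_nonneg.2 ha0.le) ht0.le (by rw [ht]; ring)
  have e : rv u x + 2 * (t / 4) * |rv h x| = a⁻¹ • (a * rv u x) + t • |2⁻¹ * rv h x| := by
    rw [smul_eq_mul, smul_eq_mul, abs_mul, abs_of_pos (by norm_num : (0 : ℝ) < 2⁻¹),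
      inv_mul_cancel_left₀ ha0.ne']
    ring
  rw [e]
  refine hconv.trans ?_
  have h1 : a⁻¹ ≤ 1 := inv_le_one_of_one_le₀ ha.le
  have h2 : t ≤ 1 := by rw [ht]; linarith [inv_pos.2 ha0]
  rw [smul_eq_mul, smul_eq_mul]
  exact add_le_add (mul_le_of_le_one_left (Real.exp_pos _).le h1)
    (mul_le_of_le_one_left (Real.exp_pos _).le h2)

/-! ### The terms of the exponential series in `L²(μ)` -/

/-- The function `h₁ ⋯ hₙ · exp (u / 2) · √p`. -/
def expTerm (p : PosDensity μ) (u : CenteredSpace p) {n : ℕ} (h : Fin n → CenteredSpace p)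
    (x : Ω) : ℝ :=
  (∏ i, rv (h i) x) * (Real.exp (rv u x / 2) * √(p.toFun x))

theorem aestronglyMeasurable_expTerm (p : PosDensity μ) (u : CenteredSpace p) {n : ℕ}
    (h : Fin n → CenteredSpace p) : AEStronglyMeasurable (expTerm p u h) μ := by
  have h1 : AEStronglyMeasurable (fun x => ∏ i, rv (h i) x) μ :=
    Finset.aestronglyMeasurable_fun_prod _ fun i _ => (rv (h i)).aestronglyMeasurable
  have h2 : AEStronglyMeasurable (fun x => Real.exp (rv u x / 2)) μ :=
    (Real.measurable_exp.comp_aemeasurable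
      ((rv u).aestronglyMeasurable.aemeasurable.div_const 2)).aestronglyMeasurable
  exact h1.mul (h2.mul (memLp_sqrt p).1)

theorem eLpNorm_expTerm_sq (p : PosDensity μ) (u : CenteredSpace p) {n : ℕ}
    (h : Fin n → CenteredSpace p) :
    eLpNorm (expTerm p u h) 2 μ ^ 2 =
      ∫⁻ x, ENNReal.ofReal ((∏ i, rv (h i) x) ^ 2 * Real.exp (rv u x)) ∂p.measure := by
  have h0 := eLpNorm_nnreal_pow_eq_lintegral (f := expTerm p u h) (μ := μ) (p := 2) two_ne_zero
  have hm : AEMeasurable (fun x =>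
      ENNReal.ofReal ((∏ i, rv (h i) x) ^ 2 * Real.exp (rv u x))) μ :=
    (((Finset.aemeasurable_fun_prod _ fun i _ =>
      (rv (h i)).aestronglyMeasurable.aemeasurable).pow_const 2).mul
      (Real.measurable_exp.comp_aemeasurable
        (rv u).aestronglyMeasurable.aemeasurable)).ennreal_ofReal
  rw [PosDensity.measure, lintegral_withDensity_eq_lintegral_mul₀
    p.toFun.aestronglyMeasurable.aemeasurable.ennreal_ofReal hm]
  simp only [NNReal.coe_ofNat, ENNReal.rpow_ofNat, ENNReal.coe_ofNat] at h0
  rw [h0]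
  refine lintegral_congr_ae ?_
  filter_upwards [p.pos] with x hx
  rw [Pi.mul_apply, ← ENNReal.ofReal_mul hx.le, ← ofReal_norm,
    ← ENNReal.ofReal_pow (norm_nonneg _), Real.norm_eq_abs, sq_abs, expTerm, mul_pow, mul_pow,
    Real.sq_sqrt hx.le, ← Real.exp_nat_mul]
  congr 1
  rw [Nat.cast_ofNat, mul_div_cancel₀ _ two_ne_zero]
  ring

/-- The product is at most the `n`-th power of its largest factor, and `x^n ≤ n! e^x`. Replacing the
maximum by a sum allows integration term by term. The summand `1` covers `n = 0`, where the sum is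
empty. -/
theorem sq_prod_le_factorial_mul {n : ℕ} (a : Fin n → ℝ) (ha : ∀ i, 0 ≤ a i) :
    (∏ i, a i) ^ 2 ≤ (n.factorial : ℝ) ^ 2 * (1 + ∑ i, Real.exp (2 * a i)) := by
  rcases Nat.eq_zero_or_pos n with rfl | hn
  · simp
  obtain ⟨j, -, hj⟩ := Finset.exists_max_image Finset.univ a ⟨⟨0, hn⟩, Finset.mem_univ _⟩
  have h1 : ∏ i, a i ≤ a j ^ n := by
    refine (Finset.prod_le_prod (fun i _ => ha i) hj).trans_eq ?_
    simp
  have h2 : a j ^ n ≤ n.factorial * Real.exp (a j) := by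
    have := Real.pow_div_factorial_le_exp (a j) (ha j) n
    rwa [div_le_iff₀' (by positivity)] at this
  have h3 : Real.exp (2 * a j) ≤ ∑ i, Real.exp (2 * a i) :=
    Finset.single_le_sum (f := fun i => Real.exp (2 * a i)) (fun i _ => (Real.exp_pos _).le)
      (Finset.mem_univ j)
  calc (∏ i, a i) ^ 2 ≤ (n.factorial * Real.exp (a j)) ^ 2 := by
        gcongr
        · exact Finset.prod_nonneg fun i _ => ha i
        · exact h1.trans h2
    _ = (n.factorial : ℝ) ^ 2 * Real.exp (2 * a j) := by
        rw [mul_pow, ← Real.exp_nat_mul, Nat.cast_ofNat]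
    _ ≤ _ := by gcongr; linarith

theorem sq_prod_mul_exp_le {c : ℝ} (hc : 0 < c) {n : ℕ} (a : Fin n → ℝ) (b : ℝ) :
    (∏ i, a i) ^ 2 * Real.exp b ≤ (n.factorial * c⁻¹ ^ n) ^ 2 *
      (Real.exp b + ∑ i, Real.exp (b + 2 * c * |a i|)) := by
  have h := sq_prod_le_factorial_mul (fun i => c * |a i|) fun i => by positivity
  rw [Finset.prod_mul_distrib, Finset.prod_const, Finset.card_univ, Fintype.card_fin, mul_pow,
    ← Finset.abs_prod, sq_abs] at h
  have h' : (∏ i, a i) ^ 2 ≤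
      (n.factorial * c⁻¹ ^ n) ^ 2 * (1 + ∑ i, Real.exp (2 * (c * |a i|))) := by
    calc (∏ i, a i) ^ 2 = (c⁻¹ ^ n) ^ 2 * ((c ^ n) ^ 2 * (∏ i, a i) ^ 2) := by
          rw [← mul_assoc, ← mul_pow, ← mul_pow, ← mul_pow, inv_mul_cancel₀ hc.ne']; simp
      _ ≤ (c⁻¹ ^ n) ^ 2 * ((n.factorial : ℝ) ^ 2 * (1 + ∑ i, Real.exp (2 * (c * |a i|)))) := by
          gcongr
      _ = _ := by ring
  refine (mul_le_mul_of_nonneg_right h' (Real.exp_pos b).le).trans_eq ?_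
  rw [mul_assoc, add_mul, one_mul, Finset.sum_mul]
  congr 3
  ext i
  rw [← Real.exp_add]
  congr 1
  ring

theorem exists_eLpNorm_expTerm_le_of_norm_le_one {p : PosDensity μ} {u : CenteredSpace p}
    (hu : u ∈ expDomain p) : ∃ B R : ℝ, 0 < B ∧ 0 < R ∧ ∀ (n : ℕ) (h : Fin n → CenteredSpace p),
      (∀ i, ‖h i‖ ≤ 1) →
        eLpNorm (expTerm p u h) 2 μ ≤ ENNReal.ofReal (B * (n.factorial * R ^ n)) := by
  obtain ⟨c, hc, C, hC, hb⟩ := exists_lintegral_exp_add_le hu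
  -- The `n + 1` integrals bounded by `C` contribute `(1 + n) C`. The factor `2` in `R` absorbs `1 +
  -- n ≤ (2^n)²`; adding `1` to `√C` keeps `B` positive even if `C = 0`.
  refine ⟨√(C.toReal) + 1, 2 * c⁻¹, by positivity, by positivity, fun n h hh => ?_⟩
  rw [← ENNReal.pow_le_pow_left_iff two_ne_zero, eLpNorm_expTerm_sq,
    ← ENNReal.ofReal_pow (by positivity)]
  -- The uniform bound at `h = 0` also controls `E_p[e^u]`.
  have hu0 : ∫⁻ x, ENNReal.ofReal (Real.exp (rv u x)) ∂p.measure ≤ C := by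
    refine (lintegral_mono fun x => ENNReal.ofReal_le_ofReal (Real.exp_le_exp.2 ?_)).trans
      (hb 0 (by simp))
    exact le_add_of_nonneg_right (by positivity)
  have hm : ∀ i, AEMeasurable
      (fun x => ENNReal.ofReal (Real.exp (rv u x + 2 * c * |rv (h i) x|))) p.measure := fun i =>
    (Real.measurable_exp.comp_aemeasurable ((p.aemeasurable _).add
      ((measurable_norm.comp_aemeasurable (p.aemeasurable _)).const_mul _))).ennreal_ofReal
  calc _ ≤ ∫⁻ x, ENNReal.ofReal ((n.factorial * c⁻¹ ^ n) ^ 2) *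
          (ENNReal.ofReal (Real.exp (rv u x)) +
            ∑ i, ENNReal.ofReal (Real.exp (rv u x + 2 * c * |rv (h i) x|))) ∂p.measure := by
        refine lintegral_mono fun x => ?_
        rw [← ENNReal.ofReal_sum_of_nonneg fun i _ => (Real.exp_pos _).le,
          ← ENNReal.ofReal_add (Real.exp_pos _).le
            (Finset.sum_nonneg fun i _ => (Real.exp_pos _).le),
          ← ENNReal.ofReal_mul (by positivity)]
        exact ENNReal.ofReal_le_ofReal (sq_prod_mul_exp_le hc _ _)
    _ ≤ ENNReal.ofReal ((n.factorial * c⁻¹ ^ n) ^ 2) * (C + n * C) := by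
        rw [lintegral_const_mul' _ _ ENNReal.ofReal_ne_top,
          lintegral_add_left' (aemeasurable_exp p u), lintegral_finsetSum' _ fun i _ => hm i]
        gcongr
        refine (Finset.sum_le_sum fun i _ => hb (h i) (hh i)).trans_eq ?_
        simp
    _ = ENNReal.ofReal ((n.factorial * c⁻¹ ^ n) ^ 2 * ((1 + n) * C.toReal)) := by
        rw [ENNReal.ofReal_mul (by positivity), ENNReal.ofReal_mul (by positivity),
          ENNReal.ofReal_toReal hC, ENNReal.ofReal_add zero_le_one (by positivity),
          ENNReal.ofReal_one, ENNReal.ofReal_natCast]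
        ring
    _ ≤ _ := by
        refine ENNReal.ofReal_le_ofReal ?_
        have h1 : (1 + n : ℝ) ≤ (2 ^ n) ^ 2 := by
          have h2 : ((n + 1 : ℕ) : ℝ) ≤ ((2 ^ n : ℕ) : ℝ) := by exact_mod_cast n.lt_two_pow_self
          push_cast at h2
          nlinarith [one_le_pow₀ (one_le_two (α := ℝ)) (n := n)]
        have h3 : C.toReal ≤ (√C.toReal + 1) ^ 2 := by
          nlinarith [Real.sq_sqrt (ENNReal.toReal_nonneg (a := C)), Real.sqrt_nonneg C.toReal]
        calc _ ≤ (n.factorial * c⁻¹ ^ n) ^ 2 * ((2 ^ n) ^ 2 * (√C.toReal + 1) ^ 2) := by gcongr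
          _ = _ := by rw [mul_pow 2 c⁻¹]; ring

theorem expTerm_smul (p : PosDensity μ) (u : CenteredSpace p) {n : ℕ} (a : Fin n → ℝ)
    (h : Fin n → CenteredSpace p) :
    expTerm p u (fun i => a i • h i) =ᵐ[μ] (∏ i, a i) • expTerm p u h := by
  filter_upwards [ae_all_iff.2 fun i => coeFn_rv_smul (a i) (h i)] with x hx
  simp only [expTerm, hx, Finset.prod_mul_distrib, Pi.smul_apply, smul_eq_mul]
  ring

theorem exists_eLpNorm_expTerm_le {p : PosDensity μ} {u : CenteredSpace p}
    (hu : u ∈ expDomain p) : ∃ B R : ℝ, 0 < B ∧ 0 < R ∧ ∀ (n : ℕ) (h : Fin n → CenteredSpace p),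
      eLpNorm (expTerm p u h) 2 μ ≤ ENNReal.ofReal (B * (n.factorial * R ^ n) * ∏ i, ‖h i‖) := by
  obtain ⟨B, R, hB, hR, H⟩ := exists_eLpNorm_expTerm_le_of_norm_le_one hu
  refine ⟨B, R, hB, hR, fun n h => ?_⟩
  -- Homogeneity reduces to the unit ball; the convention `0⁻¹ = 0` lets vanishing arguments be
  -- treated alike.
  have e : ∀ i, h i = ‖h i‖ • (‖h i‖⁻¹ • h i) := by
    intro i
    rcases eq_or_ne (h i) 0 with h0 | h0
    · simp [h0]
    · rw [smul_inv_smul₀ (norm_ne_zero_iff.2 h0)]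
  have h1 : ∀ i, ‖‖h i‖⁻¹ • h i‖ ≤ 1 := by
    intro i
    rw [norm_smul, norm_inv, norm_norm]
    exact inv_mul_le_one
  have h2 := expTerm_smul p u (fun i => ‖h i‖) fun i => ‖h i‖⁻¹ • h i
  simp only [← e] at h2
  have h3 : 0 ≤ ∏ i, ‖h i‖ := Finset.prod_nonneg fun i _ => norm_nonneg _
  rw [eLpNorm_congr_ae h2, eLpNorm_const_smul, Real.enorm_of_nonneg h3, mul_comm,
    ENNReal.ofReal_mul (by positivity)]
  gcongr
  exact H n _ h1

theorem memLp_expTerm {p : PosDensity μ} {u : CenteredSpace p} (hu : u ∈ expDomain p) {n : ℕ}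
    (h : Fin n → CenteredSpace p) : MemLp (expTerm p u h) 2 μ := by
  obtain ⟨B, R, -, -, H⟩ := exists_eLpNorm_expTerm_le hu
  exact ⟨aestronglyMeasurable_expTerm p u h, (H n h).trans_lt ENNReal.ofReal_lt_top⟩

/-! ### Analyticity of `u ↦ exp (u / 2) √p` -/

/-- The multilinear map `(h₁, …, hₙ) ↦ h₁ ⋯ hₙ · exp (u / 2) · √p` with values in `L²(μ)`. -/
def expMultilinear (p : PosDensity μ) (u : CenteredSpace p) (hu : u ∈ expDomain p) (n : ℕ) :
    MultilinearMap ℝ (fun _ : Fin n => CenteredSpace p) (Lp ℝ 2 μ) where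
  toFun h := (memLp_expTerm hu h).toLp _
  map_update_add' := by
    intro _ h i v w
    rw [← MemLp.toLp_add]
    refine MemLp.toLp_congr _ _ ?_
    filter_upwards [coeFn_rv_add v w] with x hx
    -- Evaluation at `x` is moved inside the update, so that the `i`-th factor can be split off the
    -- product.
    simp only [expTerm, Pi.add_apply, Function.apply_update (fun _ a => rv a x), hx]
    simp only [Finset.prod_update_of_mem, Finset.mem_univ]
    ring
  map_update_smul' := by
    intro _ h i c v
    rw [← MemLp.toLp_const_smul]
    refine MemLp.toLp_congr _ _ ?_
    filter_upwards [coeFn_rv_smul c v] with x hx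
    simp only [expTerm, Pi.smul_apply, smul_eq_mul, Function.apply_update (fun _ a => rv a x), hx]
    simp only [Finset.prod_update_of_mem, Finset.mem_univ]
    ring

theorem exists_norm_expMultilinear_le {p : PosDensity μ} {u : CenteredSpace p}
    (hu : u ∈ expDomain p) : ∃ B R : ℝ, 0 < B ∧ 0 < R ∧ ∀ (n : ℕ) (h : Fin n → CenteredSpace p),
      ‖expMultilinear p u hu n h‖ ≤ B * (n.factorial * R ^ n) * ∏ i, ‖h i‖ := by
  obtain ⟨B, R, hB, hR, H⟩ := exists_eLpNorm_expTerm_le hu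
  refine ⟨B, R, hB, hR, fun n h => ?_⟩
  change ‖(memLp_expTerm hu h).toLp _‖ ≤ _
  rw [Lp.norm_toLp]
  refine ENNReal.toReal_le_of_le_ofReal ?_ (H n h)
  exact mul_nonneg (by positivity) (Finset.prod_nonneg fun i _ => norm_nonneg _)

open Classical in
/-- The element `exp (u / 2) √p` of `L²(μ)`, with value `0` if this function is not square
integrable. -/
def sqrtExp (p : PosDensity μ) (u : CenteredSpace p) : Lp ℝ 2 μ :=
  if h : MemLp (fun x => Real.exp (rv u x / 2) * √(p.toFun x)) 2 μ then h.toLp _ else 0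

theorem memLp_sqrtExp {p : PosDensity μ} {u : CenteredSpace p} (hu : u ∈ expDomain p) :
    MemLp (fun x => Real.exp (rv u x / 2) * √(p.toFun x)) 2 μ := by
  have h := memLp_expTerm hu (n := 0) Fin.elim0
  convert h using 2 with x
  simp [expTerm]

theorem coeFn_sqrtExp {p : PosDensity μ} {u : CenteredSpace p} (hu : u ∈ expDomain p) :
    sqrtExp p u =ᵐ[μ] fun x => Real.exp (rv u x / 2) * √(p.toFun x) := by
  rw [sqrtExp, dif_pos (memLp_sqrtExp hu)]
  exact MemLp.coeFn_toLp _

/-- The map `u ↦ exp (u / 2) √p` has a power series expansion at every point of `𝒮_p`. -/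
theorem exists_hasFPowerSeriesAt_sqrtExp {p : PosDensity μ} {u : CenteredSpace p}
    (hu : u ∈ expDomain p) :
    ∃ P : FormalMultilinearSeries ℝ (CenteredSpace p) (Lp ℝ 2 μ),
      HasFPowerSeriesAt (sqrtExp p) P u ∧
        ∀ n h, P n h = (2 ^ n * n.factorial : ℝ)⁻¹ • expMultilinear p u hu n h := by
  obtain ⟨B, R, hB, hR, H⟩ := exists_norm_expMultilinear_le hu
  -- The Taylor factor `1/n!` cancels the factorial in the multilinear bound, leaving geometric
  -- growth `B (R/2)^n`.
  let P : FormalMultilinearSeries ℝ (CenteredSpace p) (Lp ℝ 2 μ) := fun n =>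
    (2 ^ n * n.factorial : ℝ)⁻¹ • (expMultilinear p u hu n).mkContinuous _ (H n)
  have hP : ∀ n h, P n h = (2 ^ n * n.factorial : ℝ)⁻¹ • expMultilinear p u hu n h :=
    fun n h => rfl
  have hPn : ∀ n, ‖P n‖ ≤ B * (R / 2) ^ n := by
    intro n
    refine ContinuousMultilinearMap.opNorm_le_bound (by positivity) fun h => ?_
    rw [hP, norm_smul, norm_inv, Real.norm_of_nonneg (by positivity)]
    calc _ ≤ (2 ^ n * n.factorial : ℝ)⁻¹ * (B * (n.factorial * R ^ n) * ∏ i, ‖h i‖) := by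
          gcongr; exact H n h
      _ = _ := by
          have : (n.factorial : ℝ) ≠ 0 := by positivity
          rw [div_pow]; field_simp
  obtain ⟨ε, hε, hball⟩ := Metric.isOpen_iff.1 (isOpen_expDomain p) u hu
  -- `ε` keeps `u + y` in `𝒮_p`; `R⁻¹` makes the series geometric with ratio at most `1/2`.
  let r : NNReal := ⟨min ε R⁻¹, by positivity⟩
  have hr0 : 0 < r := by
    change 0 < min ε R⁻¹
    positivity
  have hrad : (r : ℝ≥0∞) ≤ P.radius := by
    refine P.le_radius_of_bound B fun n => ?_
    have h2 : (r : ℝ) ≤ R⁻¹ := min_le_right _ _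
    calc ‖P n‖ * (r : ℝ) ^ n ≤ B * (R / 2) ^ n * R⁻¹ ^ n := by gcongr; exact hPn n
      _ = B * (1 / 2) ^ n := by
          rw [mul_assoc, ← mul_pow]; congr 2; field_simp
      _ ≤ B := mul_le_of_le_one_right hB.le (pow_le_one₀ (by norm_num) (by norm_num))
  refine ⟨P, ⟨r, hrad, by exact_mod_cast hr0, fun {y} hy => ?_⟩, hP⟩
  have hyrad : y ∈ Metric.eball 0 P.radius := Metric.eball_subset_eball hrad hy
  have huy : u + y ∈ expDomain p := by
    refine hball ?_
    have hy' : y ∈ Metric.ball 0 (r : ℝ) := by rwa [Metric.eball_coe] at hy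
    rw [mem_ball_zero_iff] at hy'
    rw [mem_ball_iff_norm, add_sub_cancel_left]
    exact hy'.trans_le (min_le_left _ _)
  have hs := P.summable_norm_apply hyrad
  have hs' : ∑' n, ‖P n fun _ => y‖ₑ ≠ ⊤ := by
    simpa only [ofReal_norm] using hs.tsum_ofReal_ne_top
  have hsum := P.hasSum hyrad
  -- Convergence in `L²` is settled, so only the limit has to be identified. An absolutely
  -- convergent series in `L²` also converges almost everywhere to its sum, and pointwise the series
  -- is that of `exp(y/2)`.
  suffices h : P.sum y = sqrtExp p (u + y) by rwa [h] at hsum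
  refine Lp.ext ?_
  have hterm : ∀ᵐ x ∂μ, ∀ n, (P n fun _ => y) x =
      (rv y x / 2) ^ n / n.factorial * (Real.exp (rv u x / 2) * √(p.toFun x)) := by
    refine ae_all_iff.2 fun n => ?_
    rw [hP]
    filter_upwards [Lp.coeFn_smul (2 ^ n * n.factorial : ℝ)⁻¹ (expMultilinear p u hu n fun _ => y),
      (memLp_expTerm hu fun _ : Fin n => y).coeFn_toLp] with x hx hx'
    rw [hx, Pi.smul_apply]
    change _ • ((memLp_expTerm hu fun _ : Fin n => y).toLp _ : Lp ℝ 2 μ) x = _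
    rw [hx', expTerm, Finset.prod_const, Finset.card_univ, Fintype.card_fin, smul_eq_mul, div_pow]
    field_simp
  filter_upwards [Lp.hasSum_coeFn_tsum hs', hterm, coeFn_sqrtExp huy, coeFn_rv_add u y]
    with x hx hxt hxe hxa
  simp only [hxt] at hx
  have hexp := (NormedSpace.expSeries_div_hasSum_exp (rv y x / 2)).mul_right
    (Real.exp (rv u x / 2) * √(p.toFun x))
  rw [← Real.exp_eq_exp_ℝ] at hexp
  change (∑' n, P n fun _ => y : Lp ℝ 2 μ) x = _
  rw [hx.unique hexp, hxe, hxa, add_div, Real.exp_add]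
  ring

theorem contDiffAt_sqrtExp {p : PosDensity μ} {u : CenteredSpace p} (hu : u ∈ expDomain p) :
    ContDiffAt ℝ ∞ (sqrtExp p) u := by
  obtain ⟨P, hP, -⟩ := exists_hasFPowerSeriesAt_sqrtExp hu
  exact hP.analyticAt.contDiffAt

theorem exists_hasFDerivAt_sqrtExp {p : PosDensity μ} {u : CenteredSpace p}
    (hu : u ∈ expDomain p) :
    ∃ D : CenteredSpace p →L[ℝ] Lp ℝ 2 μ, HasFDerivAt (sqrtExp p) D u ∧
      ∀ w, D w =ᵐ[μ] fun x => 1 / 2 * rv w x * (Real.exp (rv u x / 2) * √(p.toFun x)) := by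
  obtain ⟨P, hP, hP'⟩ := exists_hasFPowerSeriesAt_sqrtExp hu
  refine ⟨_, hP.hasFDerivAt, fun w => ?_⟩
  -- The derivative is the degree-one coefficient; `Fin.snoc 0 w` is the one-term tuple with entry
  -- `w`.
  rw [continuousMultilinearCurryFin1_apply, hP']
  filter_upwards [Lp.coeFn_smul (2 ^ 1 * Nat.factorial 1 : ℝ)⁻¹
    (expMultilinear p u hu 1 (Fin.snoc 0 w)), (memLp_expTerm hu (Fin.snoc 0 w)).coeFn_toLp]
    with x hx hx'
  rw [hx, Pi.smul_apply]
  change _ • ((memLp_expTerm hu (Fin.snoc 0 w)).toLp _ : Lp ℝ 2 μ) x = _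
  rw [hx', expTerm]
  simp [Fin.snoc]
  ring

/-! ### The square root map in an exponential chart -/

theorem sqrtMap_symm_eq_smul {p : PosDensity μ} {u : CenteredSpace p} (hu : u ∈ expDomain p) :
    (sqrtMap ((expChart p).symm u) : Lp ℝ 2 μ) =
      Real.exp (-(cumulantGen p u).toReal / 2) • sqrtExp p u := by
  have e : (expChart p).symm u = expPatch p ⟨u, hu⟩ := dif_pos hu
  rw [e]
  refine Lp.ext ?_
  filter_upwards [(memLp_sqrt (expPatch p ⟨u, hu⟩)).coeFn_toLp, coeFn_sqrtExp hu,
    Lp.coeFn_smul (Real.exp (-(cumulantGen p u).toReal / 2)) (sqrtExp p u),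
    AEEqFun.coeFn_mk _ (aestronglyMeasurable_patch p u (cumulantGen p u).toReal)] with x h1 h2 h3 h4
  rw [h3, Pi.smul_apply, h2]
  refine h1.trans ?_
  change √((AEEqFun.mk _ (aestronglyMeasurable_patch p u
      (cumulantGen p u).toReal) : Ω →ₘ[μ] ℝ) x) = _
  rw [h4, Real.sqrt_mul (Real.exp_pos _).le, ← Real.exp_half, smul_eq_mul, ← mul_assoc,
    ← Real.exp_add]
  congr 2
  ring

theorem sqrtExp_ne_zero {p : PosDensity μ} {u : CenteredSpace p} (hu : u ∈ expDomain p) :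
    sqrtExp p u ≠ 0 := by
  intro h
  have h1 := norm_eq_of_mem_sphere (sqrtMap ((expChart p).symm u))
  rw [sqrtMap_symm_eq_smul hu, h, smul_zero, norm_zero] at h1
  exact zero_ne_one h1

/-- In the chart at `p`, the square root map is the normalization of `u ↦ exp (u / 2) √p`. -/
theorem sqrtMap_symm_eq {p : PosDensity μ} {u : CenteredSpace p} (hu : u ∈ expDomain p) :
    (sqrtMap ((expChart p).symm u) : Lp ℝ 2 μ) = ‖sqrtExp p u‖⁻¹ • sqrtExp p u := by
  have h1 := norm_eq_of_mem_sphere (sqrtMap ((expChart p).symm u))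
  -- Unit norm forces the scalar `exp(-K_p(u)/2)` to be `‖F(u)‖⁻¹`.
  rw [sqrtMap_symm_eq_smul hu, norm_smul, Real.norm_of_nonneg (Real.exp_pos _).le] at h1
  rw [sqrtMap_symm_eq_smul hu, eq_inv_of_mul_eq_one_left h1]

theorem contDiffOn_sqrtMap_symm (p : PosDensity μ) :
    ContDiffOn ℝ ∞ (fun u => (sqrtMap ((expChart p).symm u) : Lp ℝ 2 μ)) (expDomain p) := by
  refine ContDiffOn.congr (fun u hu => ContDiffAt.contDiffWithinAt ?_)
    fun u hu => sqrtMap_symm_eq hu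
  have h := contDiffAt_sqrtExp hu
  exact ((h.norm ℝ (sqrtExp_ne_zero hu)).inv (norm_ne_zero_iff.2 (sqrtExp_ne_zero hu))).smul h

/-! ### The base point of the chart and the derivative of a normalized map. -/

theorem expPatch_zero (p : PosDensity μ) : expPatch p ⟨0, zero_mem_expDomain p⟩ = p := by
  have hm : momentGen p 0 = 1 := by
    have : (fun x => ENNReal.ofReal (Real.exp (rv (0 : CenteredSpace p) x))) =ᵐ[p.measure]
        fun _ => 1 := by
      filter_upwards [p.absolutelyContinuous.ae_le (coeFn_rv_zero (p := p))] with x hx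
      rw [hx, Real.exp_zero, ENNReal.ofReal_one]
    rw [momentGen, lintegral_congr_ae this]
    simp
  have hk : (cumulantGen p 0).toReal = 0 := by rw [cumulantGen, hm]; simp
  refine PosDensity.ext (AEEqFun.ext ?_)
  filter_upwards [AEEqFun.coeFn_mk _ (aestronglyMeasurable_patch p 0 (cumulantGen p 0).toReal),
    coeFn_rv_zero (p := p)] with x h1 h2
  refine h1.trans ?_
  rw [h2, hk]
  simp

theorem mem_expChart_source (p : PosDensity μ) : p ∈ (expChart p).source :=
  ⟨_, expPatch_zero p⟩

theorem expChart_self (p : PosDensity μ) : expChart p p = 0 := by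
  have h := expChartFun_patch p ⟨0, zero_mem_expDomain p⟩
  rwa [expPatch_zero] at h

theorem sqrtExp_zero (p : PosDensity μ) : sqrtExp p 0 = sqrtMap p := by
  refine Lp.ext ?_
  filter_upwards [coeFn_sqrtExp (zero_mem_expDomain p), (memLp_sqrt p).coeFn_toLp,
    coeFn_rv_zero (p := p)] with x h1 h2 h3
  refine h1.trans (Eq.trans ?_ h2.symm)
  rw [h3]
  simp

/-- The inner product is `½ E_p[w]`, which vanishes by centering: this is why `½ w √p` is tangent to
the sphere. -/
theorem inner_sqrtMap_eq_zero {p : PosDensity μ} {w : CenteredSpace p} {f : Lp ℝ 2 μ}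
    (hf : f =ᵐ[μ] fun x => 1 / 2 * rv w x * √(p.toFun x)) :
    ⟪(sqrtMap p : Lp ℝ 2 μ), f⟫ = 0 := by
  have hw : ∫ x, rv w x ∂p.measure = 0 := w.2
  rw [PosDensity.measure, integral_withDensity_eq_integral_toReal_smul₀
    p.toFun.aestronglyMeasurable.aemeasurable.ennreal_ofReal
    (Filter.Eventually.of_forall fun _ => ENNReal.ofReal_lt_top)] at hw
  rw [L2.inner_def]
  have e : (fun x => ⟪(sqrtMap p : Lp ℝ 2 μ) x, f x⟫) =ᵐ[μ]
      fun x => 1 / 2 * ((ENNReal.ofReal (p.toFun x)).toReal • rv w x) := by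
    filter_upwards [hf, (memLp_sqrt p).coeFn_toLp, p.pos] with x h1 h2 h3
    have h2 : (sqrtMap p : Lp ℝ 2 μ) x = √(p.toFun x) := h2
    rw [h1, h2, ENNReal.toReal_ofReal h3.le, RCLike.inner_apply, conj_trivial, smul_eq_mul]
    -- Only the bare density is split as `√p · √p`, not its occurrences under the root.
    nth_rewrite 3 [← Real.mul_self_sqrt h3.le]
    ring
  rw [integral_congr_ae e, integral_const_mul, hw, mul_zero]

/-- Normalization has the same derivative as the given map at a point where the map has norm `1`
and its derivative is orthogonal to its value. -/
theorem _root_.HasFDerivAt.normalize_of_inner_eq_zero {E H : Type*} [NormedAddCommGroup E]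
    [NormedSpace ℝ E] [NormedAddCommGroup H] [InnerProductSpace ℝ H] {f : E → H} {D : E →L[ℝ] H}
    {a : E} (h : HasFDerivAt f D a) (h1 : ‖f a‖ = 1) (h0 : ∀ w, ⟪f a, D w⟫ = 0) :
    HasFDerivAt (fun x => ‖f x‖⁻¹ • f x) D a := by
  have hsq : HasFDerivAt (fun x => ‖f x‖ ^ 2) (0 : E →L[ℝ] ℝ) a := by
    convert h.norm_sq using 1
    ext w
    simp [h0 w]
  have hinv : HasFDerivAt (fun x => ‖f x‖⁻¹) (0 : E →L[ℝ] ℝ) a := by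
    -- The inverse norm is `t ↦ 1/√t` applied to the squared norm, whose derivative `2⟪f a, D w⟫` is
    -- zero; the outer derivative is thus irrelevant and left implicit.
    have hd : HasDerivAt (fun t : ℝ => (√t)⁻¹) _ (‖f a‖ ^ 2) :=
      (Real.hasDerivAt_sqrt (by rw [h1]; norm_num)).inv (by rw [h1]; norm_num)
    have := hd.comp_hasFDerivAt a hsq
    rw [smul_zero] at this
    refine this.congr_of_eventuallyEq (Filter.Eventually.of_forall fun x => ?_)
    simp [Real.sqrt_sq]
  have e := hinv.smul h
  rw [ContinuousLinearMap.zero_smulRight, add_zero, h1, inv_one, one_smul] at e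
  exact e

/-! ### The projection charts of the sphere -/

section Sphere

variable {H : Type*} [NormedAddCommGroup H] [InnerProductSpace ℝ H]

/-- `sphereProj` as a continuous linear map. -/
def sphereProjL (x : Metric.sphere (0 : H) 1) : H →L[ℝ] SphereTangent x :=
  (ContinuousLinearMap.id ℝ H - (innerSL ℝ (x : H)).smulRight (x : H)).codRestrict _
    fun y => (sphereProj x y).2

/-- Each chart is a linear map restricted to the sphere, so smoothness into the sphere follows from
smoothness into the ambient space. -/
theorem sphereChart_eq_sphereProjL (x y : Metric.sphere (0 : H) 1) :
    sphereChart x y = sphereProjL x y := rfl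

theorem coe_sphereProjL_of_inner_eq_zero {x : Metric.sphere (0 : H) 1} {y : H}
    (h : ⟪(x : H), y⟫ = 0) : (sphereProjL x y : H) = y := by
  change y - ⟪(x : H), y⟫ • (x : H) = y
  rw [h, zero_smul, sub_zero]

end Sphere

/-! ### Smoothness and derivative of the square root map. -/

theorem isSmoothMap_sqrtMap (μ : Measure Ω) :
    IsSmoothMap (fun p : PosDensity μ => expChart p)
      (fun x : Metric.sphere (0 : Lp ℝ 2 μ) 1 => sphereChart x) sqrtMap := by
  refine ⟨fun p => ⟨p, mem_expChart_source p⟩, fun p => ⟨sqrtMap p, ?_⟩, fun p x => ?_⟩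
  · change 0 < ⟪(sqrtMap p : Lp ℝ 2 μ), (sqrtMap p : Lp ℝ 2 μ)⟫
    rw [inner_self_sphere]
    exact one_pos
  · dsimp only
    -- The domain of the representative becomes the part of `𝒮_p` where a continuous function, the
    -- inner product with `x`, is positive; hence it is open.
    rw [PartialEquiv.image_source_inter_eq']
    have hF := contDiffOn_sqrtMap_symm p
    constructor
    · have hc : ContinuousOn (fun u => ⟪(x : Lp ℝ 2 μ),
          (sqrtMap ((expChart p).symm u) : Lp ℝ 2 μ)⟫) (expDomain p) :=
        continuousOn_const.inner hF.continuousOn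
      exact hc.isOpen_inter_preimage (isOpen_expDomain p) isOpen_Ioi
    · exact ((sphereProjL x).contDiff.comp_contDiffOn hF).mono inter_subset_left

theorem exists_hasFDerivAt_sqrtMap (p : PosDensity μ) :
    ∃ D : CenteredSpace p →L[ℝ] SphereTangent (sqrtMap p),
      HasFDerivAt (sphereChart (sqrtMap p) ∘ sqrtMap ∘ (expChart p).symm) D (expChart p p) ∧
      HasFDerivAt (fun u => (sqrtMap ((expChart p).symm u) : Lp ℝ 2 μ))
        ((SphereTangent (sqrtMap p)).subtypeL ∘L D) (expChart p p) ∧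
      ∀ w : CenteredSpace p, ((D w : SphereTangent (sqrtMap p)) : Lp ℝ 2 μ) =ᵐ[μ]
        fun x => 1 / 2 * rv w x * √(p.toFun x) := by
  have hmem := zero_mem_expDomain p
  obtain ⟨D, hD, hDw⟩ := exists_hasFDerivAt_sqrtExp hmem
  have hD0 : ∀ w, D w =ᵐ[μ] fun x => 1 / 2 * rv w x * √(p.toFun x) := by
    intro w
    filter_upwards [hDw w, coeFn_rv_zero (p := p)] with x h1 h2
    rw [h1, h2]
    simp
  have hinner : ∀ w, ⟪(sqrtMap p : Lp ℝ 2 μ), D w⟫ = 0 := fun w => inner_sqrtMap_eq_zero (hD0 w)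
  have hF : HasFDerivAt (fun u => (sqrtMap ((expChart p).symm u) : Lp ℝ 2 μ)) D 0 := by
    refine (hD.normalize_of_inner_eq_zero ?_ ?_).congr_of_eventuallyEq ?_
    · rw [sqrtExp_zero, norm_eq_of_mem_sphere]
    · rw [sqrtExp_zero]; exact hinner
    · filter_upwards [(isOpen_expDomain p).mem_nhds hmem] with u hu using sqrtMap_symm_eq hu
  -- `D` already takes tangent values, so projecting changes only its codomain; one map therefore
  -- serves both differentiability claims.
  have hcoe : ∀ w, (sphereProjL (sqrtMap p) (D w) : Lp ℝ 2 μ) = D w := fun w =>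
    coe_sphereProjL_of_inner_eq_zero (hinner w)
  rw [expChart_self]
  refine ⟨sphereProjL (sqrtMap p) ∘L D, (sphereProjL (sqrtMap p)).hasFDerivAt.comp 0 hF, ?_,
    fun w => ?_⟩
  · exact hF.congr_fderiv (ContinuousLinearMap.ext fun w => (hcoe w).symm)
  · rw [ContinuousLinearMap.comp_apply, hcoe]
    exact hD0 w

end ExpManifold

end

theorem mainTheorem3 {Ω : Type*} [MeasurableSpace Ω] (μ : MeasureTheory.Measure Ω)
    [MeasureTheory.SigmaFinite μ] :
    ExpManifold.IsSmoothMap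
      (fun p : ExpManifold.PosDensity μ => ExpManifold.expChart p)
      (fun x : Metric.sphere (0 : MeasureTheory.Lp ℝ 2 μ) 1 => ExpManifold.sphereChart x)
      ExpManifold.sqrtMap ∧
    ∀ p : ExpManifold.PosDensity μ,
      p ∈ (ExpManifold.expChart p).source ∧
      ∃ D : ExpManifold.CenteredSpace p →L[ℝ]
          ExpManifold.SphereTangent (ExpManifold.sqrtMap p),
        HasFDerivAt
          (ExpManifold.sphereChart (ExpManifold.sqrtMap p) ∘ ExpManifold.sqrtMap ∘
            (ExpManifold.expChart p).symm)
          D (ExpManifold.expChart p p) ∧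
        HasFDerivAt
          (fun u => (ExpManifold.sqrtMap ((ExpManifold.expChart p).symm u) :
            MeasureTheory.Lp ℝ 2 μ))
          ((ExpManifold.SphereTangent (ExpManifold.sqrtMap p)).subtypeL ∘L D)
          (ExpManifold.expChart p p) ∧
        ∀ w : ExpManifold.CenteredSpace p,
          (((D w : ExpManifold.SphereTangent (ExpManifold.sqrtMap p)) :
            MeasureTheory.Lp ℝ 2 μ) : Ω → ℝ) =ᵐ[μ]
              fun x => 1 / 2 * ExpManifold.rv w x * √(p.toFun x) :=
  ⟨ExpManifold.isSmoothMap_sqrtMap μ, fun p =>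
    ⟨ExpManifold.mem_expChart_source p, ExpManifold.exists_hasFDerivAt_sqrtMap p⟩⟩
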